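/- Let $K$ be a field of characteristic zero, $\mathfrak u$ a finite-dimensional nilpotent Lie algebra over $K$ of dimension $n$, and $U=\exp(\mathfrak u)$ the corresponding unipotent group. Let $U$ act rationally on an irreducible affine variety $X$ over $K$ with coordinate algebra $\mathcal A=K[X]$, let $(T_gf)(x)=f(g^{-1}x)$ be the induced action on $\mathcal A$ and on $K(X)$, and for $x\in\mathfrak u$ let $D_x=\frac{d}{dt}\big|_{t=0}T_{\exp(tx)}$, a locally nilpotent derivation of $\mathcal A$ and of each localization of $\mathcal A$ at invariant functions. Fix a chain of ideals $\mathfrak u=\mathfrak u_n\supset\mathfrak u_{n-1}\supset\dots\supset\mathfrak u_0=0$ of $\mathfrak u$ with one-dimensional quotients. For an algebra $B$ on which the $D_x$ act, let $B^{\mathfrak u_i}=\{f\in B: D_yf=0 \text{ for all } y\in\mathfrak u_i\}$. Put $i_0=0$, $\mathcal A_0=\mathcal A$. As long as possible, for $k=1,2,\dots$, let $i_k$ be the least number $i$ with $i_{k-1}<i\le n$ and $\mathcal A_{k-1}^{\mathfrak u_{i}}\neq\mathcal A_{k-1}^{\mathfrak u_{i_{k-1}}}$, and choose $x_{i_k}\in\mathfrak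 u_{i_k}\setminus\mathfrak u_{i_k-1}$, $a_{k,1}\in\mathcal A_{k-1}^{\mathfrak u_{i_{k-1}}}$ and $0\ne a_{k,0}\in\mathcal A_{k-1}^{\mathfrak u}$ with $D_{x_{i_k}}(a_{k,1})=a_{k,0}$; let $\mathcal A_k=\mathcal A_{k-1}[a_{k,0}^{-1}]\subset K(X)$. Let $m$ be the number of steps after which no further $i_k$ exists. Put $Q_k=a_{k,1}a_{k,0}^{-1}$, $$S_k(f)=\sum_{j\ge 0}\frac{(-1)^j}{j!}D_{x_{i_k}}^j(f)\,Q_k^j,\qquad P=S_m\circ\cdots\circ S_1 .$$ Let $X_0\subset X$ be the open subset $a_{k,0}\neq0$ $(1\le k\le m)$, so that $K[X_0]=\mathcal A_m$; let $\mathcal S=\{x\in X_0: a_{k,1}(x)=0,\ 1\le k\le m\}$ (points with coordinates in an algebraic closure of $K$), and let $\mathrm{Res}:K[X_0]\to K[\mathcal S]$ be the restriction map. Theorem. Assume that the functions $a_{k,1}$, $1\le k\le m$, generate the defining ideal of $\mathcal S$ in $K[X_0]$. Let $b_1,\dots,b_s\in K[X]$ be such that $\mathrm{Res}(b_1),\dots,\mathrm{Res}(b_s),\mathrm{Res}(a_{1,0})^{\pm1},\dots,\mathrm{Res}(a_{m,0})^{\pm1}$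 generate the $K$-algebra $K[\mathcal S]$. Then $P(b_1),\dots,P(b_s),a_{1,0}^{\pm1},\dots,a_{m,0}^{\pm1}$ generate the $K$-algebra of invariants $K[X_0]^U$. In particular, they generate the field of invariants $K(X)^U$ over $K$. -/

import Mathlib

noncomputable section

/-! ### The unipotent group of a nilpotent Lie algebra -/

/-- The iterated bracket `[a₁, [a₂, [… [aᵣ₋₁, aᵣ] …]]]` of a word; a one-letter word is itself. -/
def nestedBracket {L : Type*} [LieRing L] : List L → L
  | [] => 0
  | [a] => a
  | a :: b :: l => ⁅a, nestedBracket (b :: l)⁆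

/-- The word `x^{r₁} y^{s₁} ⋯ x^{rₙ} y^{sₙ}` in the letters `x` and `y`. -/
def bchWord {L : Type*} (x y : L) {n d : ℕ} (e : Fin n → Fin d × Fin d) : List L :=
  (List.ofFn fun j =>
    List.replicate ((e j).1 : ℕ) x ++ List.replicate ((e j).2 : ℕ) y).flatten

/-- The part with `n, rⱼ, sⱼ ≤ c` of Dynkin's formula
`∑ₙ ((-1)ⁿ⁻¹ / n) ∑ [x^{r₁} y^{s₁} ⋯ x^{rₙ} y^{sₙ}] / ((∑ⱼ (rⱼ + sⱼ)) ∏ⱼ rⱼ! sⱼ!)`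
for `log (exp x · exp y)`, the inner sum over all `(rⱼ, sⱼ) ≠ (0, 0)`. -/
def dynkinSum (K : Type*) {L : Type*} [Field K] [LieRing L] [LieAlgebra K L] (c : ℕ) (x y : L) :
    L :=
  ∑ n ∈ Finset.Icc 1 c, ∑ e : Fin n → Fin (c + 1) × Fin (c + 1),
    if ∀ j, e j ≠ (0, 0) then
      (((-1 : K) ^ (n - 1) / (n : K)) *
        (((∑ j, (((e j).1 : ℕ) + ((e j).2 : ℕ)) : ℕ) : K) *
          ((∏ j, (((e j).1 : ℕ).factorial * ((e j).2 : ℕ).factorial) : ℕ) : K))⁻¹) •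
        nestedBracket (bchWord x y e)
    else 0

/-- The Baker–Campbell–Hausdorff product `log (exp x · exp y)` of a finite-dimensional nilpotent
Lie algebra over a field of characteristic zero. Brackets of more than `dim L` letters vanish, so
Dynkin's formula may be cut off at `dim L`. -/
def bch (K : Type*) {L : Type*} [Field K] [LieRing L] [LieAlgebra K L] (x y : L) : L :=
  dynkinSum K (Module.finrank K L) x y

/-- The group `U = exp L` of a finite-dimensional nilpotent Lie algebra `L` over a field of
characteristic zero: its elements are the `exp x` for `x` in `L`, with
`exp x * exp y = exp (bch x y)`. (The unit is `exp 0`, the inverse of `exp x` is `exp (-x)`.) -/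
structure ExpGroup (K L : Type*) [Field K] [LieRing L] [LieAlgebra K L] where
  /-- the element `exp x` -/
  exp ::
  /-- the inverse of the exponential map -/
  log : L

instance (K L : Type*) [Field K] [LieRing L] [LieAlgebra K L] : Mul (ExpGroup K L) :=
  ⟨fun g h => ExpGroup.exp (bch K g.log h.log)⟩

/-! ### Rational actions on an affine variety and their differentials

An irreducible affine variety `X` over `K` is given by its coordinate algebra `A = K[X]`, a finitely
generated `K`-algebra that is a domain; `FractionRing A` is the field `K(X)`. An action of `U` on
`X` is given by the automorphisms `T g` of `K[X]` with `(T g f)(x) = f (g⁻¹ x)`. A multiplicative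
map between groups is a homomorphism of groups. -/

section Action

variable {K L A : Type*} [Field K] [LieRing L] [LieAlgebra K L]
  [CommRing A] [IsDomain A] [Algebra K A]

/-- The action is rational (algebraic): for each regular function `f` the function `T (exp x) f`
depends polynomially on `x`, that is, it is given by an element of `K[L] ⊗ A`, written as a
polynomial in the linear forms on `L` with coefficients in `A`. -/
def IsRationalAction (T : ExpGroup K L →ₙ* (A ≃ₐ[K] A)) : Prop :=
  ∀ f : A, ∃ p : MvPolynomial (Module.Dual K L) A,
    ∀ x : L, T (ExpGroup.exp x) f = MvPolynomial.eval (fun φ => algebraMap K A (φ x)) p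

/-- The action of `g` on the field `K(X)`, extending the automorphism `T g` of `K[X]`. -/
def ratAct (T : ExpGroup K L →ₙ* (A ≃ₐ[K] A)) (g : ExpGroup K L) :
    FractionRing A ≃ₐ[K] FractionRing A :=
  IsFractionRing.fieldEquivOfAlgEquiv K (FractionRing A) (FractionRing A) (T g)

open Classical in
/-- The operator `D_x`, the differential of the action at the unit in the direction `x`: the
coefficient of `t` in the polynomial `exp (t x) f`. It is meant for those `f` for which
`t ↦ exp (t x) f` is polynomial, as it is on `K[X]` and on its localizations at invariant
functions (elsewhere it takes the value `0`). -/
def lieDeriv (T : ExpGroup K L →ₙ* (A ≃ₐ[K] A)) (x : L) (f : FractionRing A) : FractionRing A :=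
  if h : ∃ q : Polynomial (FractionRing A), ∀ t : K,
      ratAct T (ExpGroup.exp (t • x)) f = q.eval (algebraMap K (FractionRing A) t)
  then h.choose.coeff 1 else 0

/-- The subalgebra `A_k` of `K(X)`: the localization of `K[X]` at `a_{1,0}, …, a_{k,0}`. -/
def locAlg (K : Type*) {A : Type*} [Field K] [CommRing A] [IsDomain A] [Algebra K A]
    (a0 : ℕ → FractionRing A) (k : ℕ) : Subalgebra K (FractionRing A) :=
  Algebra.adjoin K (Set.range (algebraMap A (FractionRing A)) ∪
    {f | ∃ j, 1 ≤ j ∧ j ≤ k ∧ f = (a0 j)⁻¹})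

/-- The invariants `A_k^I` in `A_k` of an ideal `I` of the Lie algebra. -/
def lieInvariants (T : ExpGroup K L →ₙ* (A ≃ₐ[K] A)) (a0 : ℕ → FractionRing A) (k : ℕ)
    (I : LieIdeal K L) : Set (FractionRing A) :=
  {f | f ∈ locAlg K a0 k ∧ ∀ y ∈ I, lieDeriv T y f = 0}

/-- The choices made in the construction of a `U`-projector in `m` steps. The entries `index k`,
`x k`, `a0 k`, `a1 k` matter for `1 ≤ k ≤ m` only (and `index 0 = 0`). -/
structure ProjectorData (T : ExpGroup K L →ₙ* (A ≃ₐ[K] A)) (m : ℕ) where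
  /-- the ideals `L_0 ⊂ L_1 ⊂ … ⊂ L_n` with `n = dim L` -/
  chain : ℕ → LieIdeal K L
  chain_zero : chain 0 = ⊥
  chain_top : chain (Module.finrank K L) = ⊤
  chain_le : ∀ i < Module.finrank K L, chain i ≤ chain (i + 1)
  chain_codim : ∀ i < Module.finrank K L,
    Module.finrank K (chain (i + 1)) = Module.finrank K (chain i) + 1
  /-- the numbers `0 = i_0 < i_1 < … < i_m ≤ n` -/
  index : ℕ → ℕ
  /-- the elements `x_{i_k}` -/
  x : ℕ → L
  /-- the functions `a_{k,0}` -/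
  a0 : ℕ → FractionRing A
  /-- the functions `a_{k,1}` -/
  a1 : ℕ → FractionRing A
  index_zero : index 0 = 0
  /-- `i_{k+1}` is the least number beyond `i_k` at which the invariants in `A_k` change -/
  index_least : ∀ k < m, IsLeast {i | index k < i ∧ i ≤ Module.finrank K L ∧
    lieInvariants T a0 k (chain i) ≠ lieInvariants T a0 k (chain (index k))} (index (k + 1))
  x_mem : ∀ k < m, x (k + 1) ∈ chain (index (k + 1))
  x_notMem : ∀ k < m, x (k + 1) ∉ chain (index (k + 1) - 1)
  a1_mem : ∀ k < m, a1 (k + 1) ∈ lieInvariants T a0 k (chain (index k))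
  a0_mem : ∀ k < m, a0 (k + 1) ∈ lieInvariants T a0 k ⊤
  a0_ne_zero : ∀ k < m, a0 (k + 1) ≠ 0
  lieDeriv_a1 : ∀ k < m, lieDeriv T (x (k + 1)) (a1 (k + 1)) = a0 (k + 1)
  /-- the construction stops at `i_m`: the invariants in `A_m` do not change any more -/
  stop_at : ∀ i, index m ≤ i → i ≤ Module.finrank K L →
    lieInvariants T a0 m (chain i) = lieInvariants T a0 m (chain (index m))

/-- `S(f) = f - D_x(f) Q + D_x²(f) Q² / 2! - ⋯` -/
def sliceMap (T : ExpGroup K L →ₙ* (A ≃ₐ[K] A)) (x : L) (Q f : FractionRing A) :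
    FractionRing A :=
  ∑ᶠ j : ℕ, ((-1 : K) ^ j / (j.factorial : K)) • ((lieDeriv T x)^[j] f * Q ^ j)

end Action

namespace ProjectorData

variable {K L A : Type*} [Field K] [LieRing L] [LieAlgebra K L]
  [CommRing A] [IsDomain A] [Algebra K A] {T : ExpGroup K L →ₙ* (A ≃ₐ[K] A)} {m : ℕ}

/-- The composition `S_k ∘ ⋯ ∘ S_1`, where `S_k` is formed with `x_{i_k}` and
`Q_k = a_{k,1} / a_{k,0}`. -/
def partialProjector (d : ProjectorData T m) : ℕ → FractionRing A → FractionRing A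
  | 0 => id
  | k + 1 => sliceMap T (d.x (k + 1)) (d.a1 (k + 1) / d.a0 (k + 1)) ∘ d.partialProjector k

/-- The `U`-projector `P = S_m ∘ ⋯ ∘ S_1` on `K[X]`. -/
def projector (d : ProjectorData T m) (f : A) : FractionRing A :=
  d.partialProjector m (algebraMap A (FractionRing A) f)

/-- The algebra `K[X₀]` of the open subset `X₀` of `X` where `a_{1,0}, …, a_{m,0}` do not vanish. -/
def openAlg (d : ProjectorData T m) : Subalgebra K (FractionRing A) := locAlg K d.a0 m

theorem locAlg_mono {a0 : ℕ → FractionRing A} {k l : ℕ} (h : k ≤ l) :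
    locAlg K a0 k ≤ locAlg K a0 l := by
  refine Algebra.adjoin_mono (Set.union_subset_union_right _ ?_)
  rintro f ⟨j, h1, h2, rfl⟩
  exact ⟨j, h1, h2.trans h, rfl⟩

theorem algebraMap_mem_openAlg (d : ProjectorData T m) (f : A) :
    algebraMap A (FractionRing A) f ∈ d.openAlg :=
  Algebra.subset_adjoin (Or.inl ⟨f, rfl⟩)

theorem a0_mem_openAlg (d : ProjectorData T m) (k : Fin m) : d.a0 (k + 1) ∈ d.openAlg :=
  locAlg_mono k.2.le (d.a0_mem k k.2).1

theorem a0_inv_mem_openAlg (d : ProjectorData T m) (k : Fin m) : (d.a0 (k + 1))⁻¹ ∈ d.openAlg :=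
  Algebra.subset_adjoin (Or.inr ⟨k + 1, by omega, by omega, rfl⟩)

theorem a1_mem_openAlg (d : ProjectorData T m) (k : Fin m) : d.a1 (k + 1) ∈ d.openAlg :=
  locAlg_mono k.2.le (d.a1_mem k k.2).1

/-- `a_{k,0}` as a regular function on `X₀`. -/
def a0Reg (d : ProjectorData T m) (k : Fin m) : d.openAlg := ⟨_, d.a0_mem_openAlg k⟩

/-- `a_{k,0}⁻¹` as a regular function on `X₀`. -/
def a0InvReg (d : ProjectorData T m) (k : Fin m) : d.openAlg := ⟨_, d.a0_inv_mem_openAlg k⟩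

/-- `a_{k,1}` as a regular function on `X₀`. -/
def a1Reg (d : ProjectorData T m) (k : Fin m) : d.openAlg := ⟨_, d.a1_mem_openAlg k⟩

/-- A regular function on `X` as a regular function on `X₀`. -/
def toOpen (d : ProjectorData T m) (f : A) : d.openAlg := ⟨_, d.algebraMap_mem_openAlg f⟩

/-- The subset `S` of `X₀` where all `a_{k,1}` vanish. A point of `X₀` has its coordinates in an
algebraic closure of `K`: it is a homomorphism from `K[X₀]` to that field. -/
def zeroSet (d : ProjectorData T m) : Set (d.openAlg →ₐ[K] AlgebraicClosure K) :=
  {p | ∀ k, p (d.a1Reg k) = 0}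

/-- The restriction map from `K[X₀]` to the functions on `S`. Its kernel is the defining ideal of
`S` in `K[X₀]`, and its range is the algebra `K[S]` of regular functions on `S`. -/
def res (d : ProjectorData T m) : d.openAlg →ₐ[K] (d.zeroSet → AlgebraicClosure K) :=
  AlgHom.pi fun p => p.1

/-- The functions `P(b_1), …, P(b_s)` and `a_{1,0}, a_{1,0}⁻¹, …, a_{m,0}, a_{m,0}⁻¹`. -/
def generators (d : ProjectorData T m) {s : ℕ} (b : Fin s → A) : Set (FractionRing A) :=
  Set.range (fun i => d.projector (b i)) ∪ Set.range (fun k : Fin m => d.a0 (k + 1)) ∪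
    Set.range (fun k : Fin m => (d.a0 (k + 1))⁻¹)

end ProjectorData

end

/-!
Since the action is rational, the orbit map `t ↦ exp (t x) f` of a function `f` in `K[X₀]` is a
polynomial in `t`. By Taylor's formula `S_k` substitutes `t = -Q_k` in this polynomial, so it is an
algebra endomorphism of `K[X₀]`; as `exp (t x_{i_k})` translates `Q_k` by `t`, its values on the
invariants of `u_{i_k - 1}` are invariant under `u_{i_k}`, and it kills `a_{k,1}`. Hence `P` is an
algebra retraction of `K[X₀]` onto the invariants that kills the kernel of `Res`, and it maps
elements that generate `K[X₀]` modulo this kernel to generators of the invariants.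

Every rational invariant is a quotient of invariants in `K[X₀]`: if `c f` is regular with `c`
invariant under an ideal `I` and `f` invariant under `I + K x`, then the leading coefficient of the
orbit polynomial of `c` in the direction `x` is a denominator of `f` invariant under `I + K x`.
-/

noncomputable section

section Dynkin

variable {K L L' : Type*} [Field K] [LieRing L] [LieAlgebra K L] [LieRing L'] [LieAlgebra K L']

theorem map_nestedBracket (f : L →ₗ⁅K⁆ L') (l : List L) :
    f (nestedBracket l) = nestedBracket (l.map f) := by
  fun_induction nestedBracket l with
  | case1 => simp [nestedBracket]
  | case2 a => simp [nestedBracket]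
  | case3 a b l ih => simp_all [nestedBracket]

theorem map_dynkinSum (f : L →ₗ⁅K⁆ L') (c : ℕ) (x y : L) :
    f (dynkinSum K c x y) = dynkinSum K c (f x) (f y) := by
  have map_bchWord {n : ℕ} (e : Fin n → Fin (c + 1) × Fin (c + 1)) :
      (bchWord x y e).map f = bchWord (f x) (f y) e := by
    simp [bchWord, List.map_flatten, List.map_ofFn, Function.comp_def]
  simp only [dynkinSum, map_sum, apply_ite f, map_smul, map_zero, map_nestedBracket, map_bchWord]

theorem nestedBracket_eq_zero {l : List L} (hl : ∀ a ∈ l, ∀ b ∈ l, ⁅a, b⁆ = 0)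
    (h : 2 ≤ l.length) : nestedBracket l = 0 := by
  fun_induction nestedBracket l with
  | case1 => rfl
  | case2 a => simp at h
  | case3 a b l ih =>
    rcases l with _ | ⟨c, l⟩
    · exact hl a (by simp) b (by simp)
    · rw [ih (fun a' ha' b' hb' => hl a' (.tail _ ha') b' (.tail _ hb')) (by simp), lie_zero]

theorem length_bchWord {α : Type*} {n d : ℕ} (x y : α) (e : Fin n → Fin d × Fin d) :
    (bchWord x y e).length = ∑ j, (((e j).1 : ℕ) + ((e j).2 : ℕ)) := by
  simp [bchWord, List.length_flatten, List.map_ofFn, Function.comp_def, List.sum_ofFn]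

theorem eq_or_eq_of_mem_bchWord {α : Type*} {n d : ℕ} {x y a : α} {e : Fin n → Fin d × Fin d}
    (ha : a ∈ bchWord x y e) : a = x ∨ a = y := by
  simp only [bchWord, List.mem_flatten, List.mem_ofFn] at ha
  obtain ⟨_, ⟨j, rfl⟩, ha⟩ := ha
  exact (List.mem_append.1 ha).imp List.eq_of_mem_replicate List.eq_of_mem_replicate

theorem nestedBracket_bchWord_eq_zero {n d : ℕ} {x y : L} (hxy : ⁅x, y⁆ = 0)
    (e : Fin n → Fin d × Fin d) (he : 2 ≤ ∑ j, (((e j).1 : ℕ) + ((e j).2 : ℕ))) :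
    nestedBracket (bchWord x y e) = 0 := by
  have hyx : ⁅y, x⁆ = 0 := by rw [← lie_skew, hxy, neg_zero]
  refine nestedBracket_eq_zero (fun a ha b hb => ?_) (by rwa [length_bchWord])
  rcases eq_or_eq_of_mem_bchWord ha with rfl | rfl <;>
    rcases eq_or_eq_of_mem_bchWord hb with rfl | rfl <;> simp [hxy, hyx]

theorem le_sum_add_of_forall_ne {n d : ℕ} {e : Fin n → Fin (d + 1) × Fin (d + 1)}
    (he : ∀ j, e j ≠ (0, 0)) : n ≤ ∑ j, (((e j).1 : ℕ) + ((e j).2 : ℕ)) := by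
  have one_le (j : Fin n) : 1 ≤ ((e j).1 : ℕ) + ((e j).2 : ℕ) :=
    Nat.one_le_iff_ne_zero.2 fun hj => he j (by simpa [Prod.ext_iff] using hj)
  simpa using Finset.sum_le_sum fun j (_ : j ∈ Finset.univ) => one_le j

theorem dynkinSum_eq_add {c : ℕ} (hc : 1 ≤ c) {x y : L} (hxy : ⁅x, y⁆ = 0) :
    dynkinSum K c x y = x + y := by
  obtain ⟨c, rfl⟩ := Nat.exists_eq_add_of_le' hc
  rw [dynkinSum, Finset.sum_eq_single_of_mem 1 (by simp),
    Finset.sum_eq_add_of_mem (fun _ => (1, 0)) (fun _ => (0, 1)) (Finset.mem_univ _)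
      (Finset.mem_univ _) fun h => by simpa using congrFun h 0]
  · simp [bchWord, nestedBracket]
  · rintro e - ⟨h10, h01⟩
    split_ifs with he
    · obtain ⟨p, rfl⟩ : ∃ p, e = fun _ => p := ⟨e 0, funext fun j => by rw [Subsingleton.elim j 0]⟩
      rw [nestedBracket_bchWord_eq_zero hxy, smul_zero]
      have h00 := he 0
      simp only [ne_eq, funext_iff, forall_const, Prod.ext_iff, Fin.ext_iff, Fin.val_zero,
        Fin.val_one, Fintype.sum_unique] at h00 h10 h01 ⊢
      omega
    · rfl
  · intro n hn hn1
    refine Finset.sum_eq_zero fun e _ => ?_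
    split_ifs with he
    · have hn2 : 2 ≤ n := by have := Finset.mem_Icc.1 hn; omega
      rw [nestedBracket_bchWord_eq_zero hxy e (hn2.trans (le_sum_add_of_forall_ne he)), smul_zero]
    · rfl

variable [FiniteDimensional K L]

theorem bch_sub_add_mem (I : LieIdeal K L) {x y : L} (hxy : ⁅x, y⁆ ∈ I) :
    bch K x y - (x + y) ∈ I := by
  rcases Nat.eq_zero_or_pos (Module.finrank K L) with h | h
  · have := Module.finrank_zero_iff.1 h
    rw [Subsingleton.elim (bch K x y - (x + y)) 0]
    exact I.zero_mem
  · let π : L →ₗ⁅K⁆ L ⧸ I :=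
      { (LieSubmodule.Quotient.mk' I : L →ₗ[K] L ⧸ I) with
        map_lie' := LieSubmodule.Quotient.mk_bracket I _ _ }
    have hπ : ∀ a, π a = 0 ↔ a ∈ I := fun a => LieSubmodule.Quotient.mk_eq_zero I
    rw [← hπ, LieHom.map_lie] at hxy
    rw [← hπ, map_sub, map_add, bch, map_dynkinSum, dynkinSum_eq_add h hxy, sub_self]

theorem bch_eq_add {x y : L} (hxy : ⁅x, y⁆ = 0) : bch K x y = x + y := by
  have h := bch_sub_add_mem (K := K) ⊥ ((LieSubmodule.mem_bot _).2 hxy)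
  rwa [LieSubmodule.mem_bot, sub_eq_zero] at h

end Dynkin

section Action

variable {K L A : Type*} [Field K] [LieRing L] [LieAlgebra K L] [CommRing A] [IsDomain A]
  [Algebra K A]

theorem ratAct_algebraMap (T : ExpGroup K L →ₙ* (A ≃ₐ[K] A)) (g : ExpGroup K L) (a : A) :
    ratAct T g (algebraMap A (FractionRing A) a) = algebraMap A (FractionRing A) (T g a) :=
  IsFractionRing.fieldEquivOfAlgEquiv_algebraMap ..

theorem ratAct_mul (T : ExpGroup K L →ₙ* (A ≃ₐ[K] A)) (g h : ExpGroup K L) (f : FractionRing A) :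
    ratAct T (g * h) f = ratAct T g (ratAct T h f) := by
  obtain ⟨a, b, -, rfl⟩ := IsFractionRing.div_surjective A f
  simp only [map_div₀, ratAct_algebraMap, map_mul, AlgEquiv.mul_apply]

theorem ratAct_exp_exp (T : ExpGroup K L →ₙ* (A ≃ₐ[K] A)) (x y : L) (f : FractionRing A) :
    ratAct T (.exp x) (ratAct T (.exp y) f) = ratAct T (.exp (bch K x y)) f :=
  (ratAct_mul T _ _ f).symm

/-- The field of rational functions fixed by `exp V` for a subspace `V` of the Lie algebra.
For an ideal `V` these are the rational invariants of the normal subgroup `exp V`, and for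
`V = ⊤` they form `K(X)^U`. -/
def fixedField (T : ExpGroup K L →ₙ* (A ≃ₐ[K] A)) (V : Submodule K L) :
    IntermediateField K (FractionRing A) where
  carrier := {f | ∀ y ∈ V, ratAct T (.exp y) f = f}
  mul_mem' hf hg y hy := by rw [map_mul, hf y hy, hg y hy]
  add_mem' hf hg y hy := by rw [map_add, hf y hy, hg y hy]
  algebraMap_mem' c _ _ := AlgEquiv.commutes _ c
  inv_mem' f hf y hy := by rw [map_inv₀, hf y hy]

variable {T : ExpGroup K L →ₙ* (A ≃ₐ[K] A)} {f : FractionRing A}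

theorem mem_fixedField {V : Submodule K L} :
    f ∈ fixedField T V ↔ ∀ y ∈ V, ratAct T (.exp y) f = f := Iff.rfl

theorem mem_fixedField_top : f ∈ fixedField T (⊤ : Submodule K L) ↔ ∀ g, ratAct T g f = f :=
  ⟨fun h g => h g.log trivial, fun h _ _ => h _⟩

theorem mem_fixedField_span_singleton {x : L} :
    f ∈ fixedField T (K ∙ x) ↔ ∀ t : K, ratAct T (.exp (t • x)) f = f := by
  simp only [mem_fixedField, Submodule.mem_span_singleton, forall_exists_index,
    forall_apply_eq_imp_iff]

theorem fixedField_anti : Antitone (fixedField T) := fun _ _ h _ hf y hy => hf y (h hy)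

theorem mem_fixedField_iff_forall_span {V : Submodule K L} :
    f ∈ fixedField T V ↔ ∀ y ∈ V, f ∈ fixedField T (K ∙ y) :=
  ⟨fun h _ hy => fixedField_anti ((Submodule.span_singleton_le_iff_mem _ _).2 hy) h,
    fun h y hy => h y hy y (Submodule.mem_span_singleton_self y)⟩

variable [FiniteDimensional K L]

theorem ratAct_exp_smul_smul (T : ExpGroup K L →ₙ* (A ≃ₐ[K] A)) (x : L) (s t : K)
    (f : FractionRing A) :
    ratAct T (.exp (s • x)) (ratAct T (.exp (t • x)) f) = ratAct T (.exp ((s + t) • x)) f := by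
  rw [ratAct_exp_exp, bch_eq_add (by simp), add_smul]

theorem ratAct_exp_zero (T : ExpGroup K L →ₙ* (A ≃ₐ[K] A)) (f : FractionRing A) :
    ratAct T (.exp (0 : L)) f = f :=
  (ratAct T (.exp (0 : L))).injective <| by rw [ratAct_exp_exp, bch_eq_add (by simp), add_zero]

theorem ratAct_exp_neg (T : ExpGroup K L →ₙ* (A ≃ₐ[K] A)) (x : L) (f : FractionRing A) :
    ratAct T (.exp x) (ratAct T (.exp (-x)) f) = f := by
  rw [ratAct_exp_exp, bch_eq_add (by simp), add_neg_cancel, ratAct_exp_zero]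

theorem fixedField_bot : fixedField T (⊥ : Submodule K L) = ⊤ :=
  top_le_iff.1 fun f _ y hy => by rw [(Submodule.mem_bot K).1 hy, ratAct_exp_zero]

theorem ratAct_exp_eq_of_sub_mem {I : LieIdeal K L} (hf : f ∈ fixedField T I.toSubmodule) {x y : L}
    (hxy : y - x ∈ I) : ratAct T (.exp y) f = ratAct T (.exp x) f := by
  have hlie : ⁅-x, y⁆ ∈ I := by simpa using lie_mem_right K L I (-x) _ hxy
  have hbch : bch K (-x) y ∈ I := by
    simpa only [neg_add_eq_sub, sub_add_cancel] using add_mem (bch_sub_add_mem I hlie) hxy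
  rw [← ratAct_exp_neg T x (ratAct T (.exp y) f), ratAct_exp_exp T (-x), hf _ hbch]

theorem ratAct_exp_mem_fixedField {I : LieIdeal K L} (hf : f ∈ fixedField T I.toSubmodule) (x : L) :
    ratAct T (.exp x) f ∈ fixedField T I.toSubmodule := by
  intro y hy
  rw [ratAct_exp_exp]
  refine ratAct_exp_eq_of_sub_mem hf ?_
  simpa only [sub_add_eq_sub_sub_swap, sub_add_cancel] using
    add_mem (bch_sub_add_mem I (lie_mem_left K L I y x hy)) hy

theorem fixedField_sup (I : LieIdeal K L) (V : Submodule K L) :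
    fixedField T (I.toSubmodule ⊔ V) = fixedField T I.toSubmodule ⊓ fixedField T V := by
  refine le_antisymm (le_inf (fixedField_anti le_sup_left) (fixedField_anti le_sup_right)) ?_
  rintro f ⟨hI, hV⟩ _ hy
  obtain ⟨u, hu, v, hv, rfl⟩ := Submodule.mem_sup.1 hy
  rw [ratAct_exp_eq_of_sub_mem (x := v) hI (by simpa using hu), hV v hv]

end Action

section OrbitPolynomial

open Polynomial

theorem eq_of_forall_eval_algebraMap {R F : Type*} [CommSemiring R] [Infinite R] [CommRing F]
    [IsDomain F] [Algebra R F] [FaithfulSMul R F] {p q : F[X]}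
    (h : ∀ t : R, p.eval (algebraMap R F t) = q.eval (algebraMap R F t)) : p = q :=
  eq_of_infinite_eval_eq p q <|
    (Set.infinite_range_of_injective (FaithfulSMul.algebraMap_injective R F)).mono <|
      Set.range_subset_iff.2 h

variable {K L A : Type*} [Field K] [LieRing L] [LieAlgebra K L] [CommRing A] [IsDomain A]
  [Algebra K A]

/-- The polynomial `q` describes the orbit map `t ↦ exp (t x) f`. -/
def IsOrbitPoly (T : ExpGroup K L →ₙ* (A ≃ₐ[K] A)) (x : L) (f : FractionRing A)
    (q : (FractionRing A)[X]) : Prop :=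
  ∀ t : K, ratAct T (.exp (t • x)) f = q.eval (algebraMap K (FractionRing A) t)

variable {T : ExpGroup K L →ₙ* (A ≃ₐ[K] A)} {x : L} {f g Q : FractionRing A}
  {p q r : (FractionRing A)[X]}

namespace IsOrbitPoly

theorem add (hf : IsOrbitPoly T x f p) (hg : IsOrbitPoly T x g q) :
    IsOrbitPoly T x (f + g) (p + q) := fun t => by rw [map_add, hf, hg, eval_add]

theorem mul (hf : IsOrbitPoly T x f p) (hg : IsOrbitPoly T x g q) :
    IsOrbitPoly T x (f * g) (p * q) := fun t => by rw [map_mul, hf, hg, eval_mul]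

theorem of_mem_fixedField (hf : f ∈ fixedField T (K ∙ x)) : IsOrbitPoly T x f (C f) :=
  fun t => by rw [mem_fixedField_span_singleton.1 hf, eval_C]

theorem coeff_zero [FiniteDimensional K L] (h : IsOrbitPoly T x f q) : q.coeff 0 = f := by
  simpa [coeff_zero_eq_eval_zero, ratAct_exp_zero] using (h 0).symm

section Infinite

variable [Infinite K]

theorem unique (hp : IsOrbitPoly T x f p) (hq : IsOrbitPoly T x f q) : p = q :=
  eq_of_forall_eval_algebraMap fun t => by rw [← hp, ← hq]

theorem lieDeriv_eq (h : IsOrbitPoly T x f q) : lieDeriv T x f = q.coeff 1 := by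
  have hex : ∃ q, IsOrbitPoly T x f q := ⟨q, h⟩
  rw [unique h hex.choose_spec]
  exact dif_pos hex

theorem map_eq (h : IsOrbitPoly T x f q) (σ : FractionRing A ≃ₐ[K] FractionRing A)
    (hr : ∀ t : K, σ (ratAct T (.exp (t • x)) f) = r.eval (algebraMap K (FractionRing A) t)) :
    q.map (σ : FractionRing A →+* FractionRing A) = r :=
  eq_of_forall_eval_algebraMap fun t => by
    rw [← hr, h]
    simpa only [RingHom.coe_coe, AlgEquiv.commutes] using
      eval_map_apply (σ : FractionRing A →+* FractionRing A) (algebraMap K _ t)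

variable [FiniteDimensional K L]

theorem map_ratAct (h : IsOrbitPoly T x f q) (s : K) :
    q.map (ratAct T (.exp (s • x)) : FractionRing A →+* FractionRing A) =
      taylor (algebraMap K (FractionRing A) s) q :=
  h.map_eq _ fun t => by rw [ratAct_exp_smul_smul, h, taylor_eval, map_add, add_comm]

theorem map_ratAct_of_mem_fixedField {I : LieIdeal K L} (h : IsOrbitPoly T x f q)
    (hf : f ∈ fixedField T I.toSubmodule) {y : L} (hy : y ∈ I) :
    q.map (ratAct T (.exp y) : FractionRing A →+* FractionRing A) = q :=
  h.map_eq _ fun t => by rw [ratAct_exp_mem_fixedField hf _ y hy, h]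

theorem derivative (h : IsOrbitPoly T x f q) :
    IsOrbitPoly T x (lieDeriv T x f) (Polynomial.derivative q) := fun s => by
  rw [h.lieDeriv_eq, ← taylor_coeff_one, ← h.map_ratAct, coeff_map]
  rfl

theorem leadingCoeff_mem_fixedField_sup {I : LieIdeal K L} (h : IsOrbitPoly T x f q)
    (hf : f ∈ fixedField T I.toSubmodule) :
    q.leadingCoeff ∈ fixedField T (I.toSubmodule ⊔ K ∙ x) := by
  have apply_leadingCoeff (σ : FractionRing A ≃ₐ[K] FractionRing A) :
      σ q.leadingCoeff = (q.map (σ : FractionRing A →+* FractionRing A)).leadingCoeff :=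
    (leadingCoeff_map (σ : FractionRing A →+* FractionRing A)).symm
  rw [fixedField_sup]
  refine ⟨fun y hy => ?_, mem_fixedField_span_singleton.2 fun t => ?_⟩
  · rw [apply_leadingCoeff, h.map_ratAct_of_mem_fixedField hf hy]
  · rw [apply_leadingCoeff, h.map_ratAct, leadingCoeff_taylor]

end Infinite

variable [CharZero K] [FiniteDimensional K L]

theorem iterate_derivative (h : IsOrbitPoly T x f q) (j : ℕ) :
    IsOrbitPoly T x ((lieDeriv T x)^[j] f) (Polynomial.derivative^[j] q) := by
  induction j with
  | zero => exact h
  | succ j ih =>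
    rw [Function.iterate_succ_apply', Function.iterate_succ_apply']
    exact ih.derivative

theorem iterate_lieDeriv_eq (h : IsOrbitPoly T x f q) (j : ℕ) :
    (lieDeriv T x)^[j] f = j.factorial • q.coeff j := by
  rw [← (h.iterate_derivative j).coeff_zero, coeff_iterate_derivative, zero_add,
    Nat.descFactorial_self]

theorem eq_C_mul_X_add_C (h : IsOrbitPoly T x f q)
    (hf : lieDeriv T x f ∈ fixedField T (K ∙ x)) : q = C (lieDeriv T x f) * X + C f := by
  have : CharZero (FractionRing A) :=
    charZero_of_injective_algebraMap (algebraMap K (FractionRing A)).injective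
  have hq : Polynomial.derivative q = C (lieDeriv T x f) :=
    h.derivative.unique (.of_mem_fixedField hf)
  have hsub : q - C (lieDeriv T x f) * X = C f := by
    rw [eq_C_of_derivative_eq_zero (p := q - C (lieDeriv T x f) * X) (by simp [hq])]
    simp [h.coeff_zero]
  rw [← hsub, add_sub_cancel]

theorem lieDeriv_eq_zero_iff (h : IsOrbitPoly T x f q) :
    lieDeriv T x f = 0 ↔ f ∈ fixedField T (K ∙ x) := by
  refine ⟨fun h0 => mem_fixedField_span_singleton.2 fun t => ?_, fun hf => ?_⟩
  · rw [h, h.eq_C_mul_X_add_C (h0 ▸ zero_mem _), h0]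
    simp
  · rw [(of_mem_fixedField hf).lieDeriv_eq, coeff_C_succ]

theorem sliceMap_eq (h : IsOrbitPoly T x f q) : sliceMap T x Q f = q.eval (-Q) := by
  have : CharZero (FractionRing A) :=
    charZero_of_injective_algebraMap (algebraMap K (FractionRing A)).injective
  have hterm (j : ℕ) : ((-1 : K) ^ j / (j.factorial : K)) • ((lieDeriv T x)^[j] f * Q ^ j) =
      q.coeff j * (-Q) ^ j := by
    have hj : (j.factorial : FractionRing A) ≠ 0 := Nat.cast_ne_zero.2 j.factorial_ne_zero
    rw [h.iterate_lieDeriv_eq, Algebra.smul_def, neg_pow Q, nsmul_eq_mul]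
    simp only [map_div₀, map_pow, map_neg, map_one, map_natCast]
    field_simp
  rw [sliceMap, finsum_congr hterm, eval_eq_sum_range, finsum_eq_sum_of_support_subset]
  intro j hj
  have : q.coeff j ≠ 0 := left_ne_zero_of_mul hj
  simpa [Nat.lt_succ_iff] using le_natDegree_of_ne_zero this

theorem ratAct_sliceMap (h : IsOrbitPoly T x f q) (g : ExpGroup K L) :
    ratAct T g (sliceMap T x Q f) =
      (q.map (ratAct T g : FractionRing A →+* FractionRing A)).eval (-ratAct T g Q) := by
  rw [h.sliceMap_eq, ← map_neg]
  exact (eval_map_apply (ratAct T g : FractionRing A →+* FractionRing A) _).symm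

theorem sliceMap_mem_fixedField {I : LieIdeal K L} (h : IsOrbitPoly T x f q)
    (hf : f ∈ fixedField T I.toSubmodule) (hQ : Q ∈ fixedField T I.toSubmodule) :
    sliceMap T x Q f ∈ fixedField T I.toSubmodule := fun y hy => by
  rw [h.ratAct_sliceMap, h.map_ratAct_of_mem_fixedField hf hy, hQ y hy, h.sliceMap_eq]

theorem sliceMap_mem_fixedField_span (h : IsOrbitPoly T x f q) (hQ : IsOrbitPoly T x Q (X + C Q)) :
    sliceMap T x Q f ∈ fixedField T (K ∙ x) := mem_fixedField_span_singleton.2 fun t => by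
  rw [h.ratAct_sliceMap, h.map_ratAct, taylor_eval, hQ, eval_add, eval_X, eval_C, neg_add_rev,
    neg_add_cancel_right, h.sliceMap_eq]

end IsOrbitPoly

theorem sliceMap_eq_self [CharZero K] [FiniteDimensional K L] (hf : f ∈ fixedField T (K ∙ x)) :
    sliceMap T x Q f = f := by
  rw [(IsOrbitPoly.of_mem_fixedField hf).sliceMap_eq, eval_C]

/-- The orbit maps `t ↦ exp (t x) f` of all elements `f` of `B` are polynomial, with coefficients
in `B`. Such algebras are those on which `D_x` is meaningful and locally nilpotent. -/
def HasOrbitPolys (T : ExpGroup K L →ₙ* (A ≃ₐ[K] A)) (B : Subalgebra K (FractionRing A)) : Prop :=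
  ∀ f ∈ B, ∀ x : L, ∃ q ∈ lifts (algebraMap B (FractionRing A)), IsOrbitPoly T x f q

theorem exists_isOrbitPoly_algebraMap (hT : IsRationalAction T) (x : L) (a : A) :
    ∃ q : A[X], IsOrbitPoly T x (algebraMap A (FractionRing A) a)
      (q.map (algebraMap A (FractionRing A))) := by
  obtain ⟨p, hp⟩ := hT a
  refine ⟨p.eval₂ C fun φ => C (algebraMap K A (φ x)) * X, fun t => ?_⟩
  rw [ratAct_algebraMap, hp, IsScalarTower.algebraMap_apply K A (FractionRing A), eval_map_apply,
    ← coe_evalRingHom, MvPolynomial.hom_eval₂, ← MvPolynomial.eval₂_id]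
  congr 2
  · ext; simp
  · funext φ
    rw [coe_evalRingHom, eval_C_mul, eval_X, map_smul, smul_eq_mul, map_mul, mul_comm]

theorem hasOrbitPolys_adjoin {s : Set (FractionRing A)} (hs : ∀ f ∈ s, ∀ x : L,
    ∃ q ∈ lifts (algebraMap (Algebra.adjoin K s) (FractionRing A)), IsOrbitPoly T x f q) :
    HasOrbitPolys T (Algebra.adjoin K s) := by
  intro f hf x
  induction hf using Algebra.adjoin_induction with
  | mem f hf => exact hs f hf x
  | algebraMap c =>
    exact ⟨_, C'_mem_lifts ⟨algebraMap K _ c, rfl⟩,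
      .of_mem_fixedField (IntermediateField.algebraMap_mem _ c)⟩
  | add f g _ _ hf hg =>
    obtain ⟨p, hpB, hp⟩ := hf
    obtain ⟨q, hqB, hq⟩ := hg
    exact ⟨p + q, add_mem hpB hqB, hp.add hq⟩
  | mul f g _ _ hf hg =>
    obtain ⟨p, hpB, hp⟩ := hf
    obtain ⟨q, hqB, hq⟩ := hg
    exact ⟨p * q, mul_mem hpB hqB, hp.mul hq⟩

theorem hasOrbitPolys_locAlg (hT : IsRationalAction T) {a0 : ℕ → FractionRing A} {k : ℕ}
    (h : ∀ j, 1 ≤ j → j ≤ k → a0 j ∈ fixedField T (⊤ : Submodule K L)) :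
    HasOrbitPolys T (locAlg K a0 k) := by
  refine hasOrbitPolys_adjoin ?_
  rintro _ (⟨a, rfl⟩ | ⟨j, hj, hjk, rfl⟩) x
  · obtain ⟨q, hq⟩ := exists_isOrbitPoly_algebraMap hT x a
    refine ⟨_, (lifts_iff_coeff_lifts _).2 fun i => ?_, hq⟩
    rw [coeff_map]
    exact ⟨⟨_, Algebra.subset_adjoin (.inl ⟨q.coeff i, rfl⟩)⟩, rfl⟩
  · exact ⟨_, C'_mem_lifts ⟨⟨_, Algebra.subset_adjoin (.inr ⟨j, hj, hjk, rfl⟩)⟩, rfl⟩,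
      .of_mem_fixedField (fixedField_anti le_top (inv_mem (h j hj hjk)))⟩

namespace HasOrbitPolys

variable {B : Subalgebra K (FractionRing A)} [FiniteDimensional K L]

theorem exists_mul_mem_of_mem_fixedField_span [Infinite K] (hB : HasOrbitPolys T B)
    {I : LieIdeal K L} {a : FractionRing A} (haB : a ∈ B) (ha0 : a ≠ 0)
    (ha : a ∈ fixedField T I.toSubmodule) (hf : f ∈ fixedField T (K ∙ x)) (haf : a * f ∈ B) :
    ∃ c ∈ B, c ≠ 0 ∧ c ∈ fixedField T (I.toSubmodule ⊔ K ∙ x) ∧ c * f ∈ B := by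
  have coeff_mem {q : (FractionRing A)[X]} (hq : q ∈ lifts (algebraMap B (FractionRing A)))
      (i : ℕ) : q.coeff i ∈ B := by
    obtain ⟨b, hb⟩ := (lifts_iff_coeff_lifts q).1 hq i
    exact hb ▸ b.2
  obtain ⟨p, hpB, hp⟩ := hB a haB x
  obtain ⟨q, hqB, hq⟩ := hB (a * f) haf x
  have hqp : q = p * C f := hq.unique (hp.mul (.of_mem_fixedField hf))
  have hp0 : p ≠ 0 := fun h => ha0 (by rw [← hp.coeff_zero, h, Polynomial.coeff_zero])
  refine ⟨p.leadingCoeff, coeff_mem hpB _, leadingCoeff_ne_zero.2 hp0,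
    hp.leadingCoeff_mem_fixedField_sup ha, ?_⟩
  rw [leadingCoeff, ← coeff_mul_C, ← hqp]
  exact coeff_mem hqB _

variable [CharZero K]

theorem mem_fixedField_iff (hB : HasOrbitPolys T B) (hf : f ∈ B) (I : LieIdeal K L) :
    f ∈ fixedField T I.toSubmodule ↔ ∀ y ∈ I, lieDeriv T y f = 0 := by
  rw [mem_fixedField_iff_forall_span]
  refine forall₂_congr fun y _ => ?_
  obtain ⟨q, -, hq⟩ := hB f hf y
  exact hq.lieDeriv_eq_zero_iff.symm

/-- The map `S`, formed with `x` and an element `Q` of `B`, as an endomorphism of the algebra `B`: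
it is multiplicative because it substitutes `-Q` for `t` in `exp (t x) f`. -/
def sliceHom (hB : HasOrbitPolys T B) (x : L) (Q : B) : B →ₐ[K] B where
  toFun f := ⟨sliceMap T x Q f, by
    obtain ⟨_, ⟨q, rfl⟩, hq⟩ := hB f f.2 x
    rw [hq.sliceMap_eq, ← NegMemClass.coe_neg]
    exact (eval_map_apply (algebraMap B (FractionRing A)) (-Q)) ▸ (q.eval (-Q)).2⟩
  map_one' := Subtype.ext (sliceMap_eq_self (one_mem _))
  map_zero' := Subtype.ext (sliceMap_eq_self (zero_mem _))
  map_add' f g := Subtype.ext (by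
    obtain ⟨p, -, hp⟩ := hB f f.2 x
    obtain ⟨q, -, hq⟩ := hB g g.2 x
    simp only [Subalgebra.coe_add, (hp.add hq).sliceMap_eq, hp.sliceMap_eq, hq.sliceMap_eq,
      eval_add])
  map_mul' f g := Subtype.ext (by
    obtain ⟨p, -, hp⟩ := hB f f.2 x
    obtain ⟨q, -, hq⟩ := hB g g.2 x
    simp only [Subalgebra.coe_mul, (hp.mul hq).sliceMap_eq, hp.sliceMap_eq, hq.sliceMap_eq,
      eval_mul])
  commutes' c := Subtype.ext (sliceMap_eq_self (IntermediateField.algebraMap_mem _ c))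

end HasOrbitPolys

end OrbitPolynomial

theorem adjoin_image_eq_range_of_ker_le {R B C D : Type*} [CommSemiring R] [Ring B] [Ring C]
    [Ring D] [Algebra R B] [Algebra R C] [Algebra R D] {ρ : B →ₐ[R] C} {φ : B →ₐ[R] D}
    (hker : RingHom.ker ρ ≤ RingHom.ker φ) {s : Set B} (hs : Algebra.adjoin R (ρ '' s) = ρ.range) :
    Algebra.adjoin R (φ '' s) = φ.range := by
  rw [← AlgHom.map_adjoin] at hs ⊢
  refine le_antisymm (fun _ ⟨b, _, hb⟩ => ⟨b, hb⟩) ?_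
  rintro _ ⟨b, rfl⟩
  obtain ⟨c, hc, hcb⟩ : ρ b ∈ (Algebra.adjoin R s).map ρ := hs ▸ ⟨b, rfl⟩
  exact ⟨c, hc, (RingHom.sub_mem_ker_iff φ).1 (hker ((RingHom.sub_mem_ker_iff ρ).2 hcb))⟩

namespace ProjectorData

variable {K L A : Type*} [Field K] [LieRing L] [LieAlgebra K L]
  [CommRing A] [IsDomain A] [Algebra K A] {T : ExpGroup K L →ₙ* (A ≃ₐ[K] A)} {m : ℕ}
  (d : ProjectorData T m)

theorem chain_mono {i j : ℕ} (hij : i ≤ j) (hj : j ≤ Module.finrank K L) :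
    d.chain i ≤ d.chain j := by
  induction j, hij using Nat.le_induction with
  | base => exact le_rfl
  | succ j _ ih => exact (ih (by omega)).trans (d.chain_le j (by omega))

theorem exists_mem_chain_succ {i : ℕ} (hi : i < Module.finrank K L) :
    ∃ x ∈ d.chain (i + 1), x ∉ d.chain i := by
  by_contra! h
  have hcodim := d.chain_codim i hi
  rw [le_antisymm h (d.chain_le i hi)] at hcodim
  omega

theorem index_lt {k : ℕ} (hk : k < m) : d.index k < d.index (k + 1) := (d.index_least k hk).1.1

theorem index_le {k : ℕ} (hk : k ≤ m) : d.index k ≤ Module.finrank K L := by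
  cases k with
  | zero => simp [d.index_zero]
  | succ k => exact (d.index_least k hk).1.2.1

/-- The function `Q_k`, on which `exp (t x_{i_k})` acts as the translation `Q_k ↦ Q_k + t`. -/
def slice (k : ℕ) : FractionRing A := d.a1 k / d.a0 k

theorem slice_mem_openAlg {k : ℕ} (hk : k < m) : d.slice (k + 1) ∈ d.openAlg := by
  rw [slice, div_eq_mul_inv]
  exact mul_mem (d.a1_mem_openAlg ⟨k, hk⟩) (d.a0_inv_mem_openAlg ⟨k, hk⟩)

theorem partialProjector_succ (k : ℕ) (f : FractionRing A) : d.partialProjector (k + 1) f =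
    sliceMap T (d.x (k + 1)) (d.slice (k + 1)) (d.partialProjector k f) := rfl

variable [FiniteDimensional K L]

theorem chain_succ_eq_sup {i : ℕ} (hi : i < Module.finrank K L) {x : L}
    (hx : x ∈ d.chain (i + 1)) (hx' : x ∉ d.chain i) :
    (d.chain (i + 1)).toSubmodule = (d.chain i).toSubmodule ⊔ K ∙ x := by
  have hle : (d.chain i).toSubmodule ⊔ K ∙ x ≤ (d.chain (i + 1)).toSubmodule :=
    sup_le (d.chain_le i hi) ((Submodule.span_singleton_le_iff_mem _ _).2 hx)
  refine (Submodule.eq_of_le_of_finrank_le hle ?_).symm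
  rw [Submodule.finrank_sup_span_singleton hx']
  exact (d.chain_codim i hi).le

variable [CharZero K]

theorem a0_mem_fixedField_top (hT : IsRationalAction T) {k : ℕ} (hk : k < m) :
    d.a0 (k + 1) ∈ fixedField T (⊤ : Submodule K L) := by
  induction k using Nat.strong_induction_on with
  | _ k ih =>
    have hB : HasOrbitPolys T (locAlg K d.a0 k) := hasOrbitPolys_locAlg hT fun j hj hjk => by
      obtain ⟨j, rfl⟩ := Nat.exists_eq_add_of_le' hj
      exact ih j (by omega) (by omega)
    obtain ⟨hmem, hlie⟩ := d.a0_mem k hk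
    exact (hB.mem_fixedField_iff hmem ⊤).2 hlie

theorem hasOrbitPolys (hT : IsRationalAction T) {k : ℕ} (hk : k ≤ m) :
    HasOrbitPolys T (locAlg K d.a0 k) :=
  hasOrbitPolys_locAlg hT fun j hj hjk => by
    obtain ⟨j, rfl⟩ := Nat.exists_eq_add_of_le' hj
    exact d.a0_mem_fixedField_top hT (by omega)

theorem mem_lieInvariants_iff (hT : IsRationalAction T) {k : ℕ} (hk : k ≤ m) {f : FractionRing A}
    {I : LieIdeal K L} :
    f ∈ lieInvariants T d.a0 k I ↔ f ∈ locAlg K d.a0 k ∧ f ∈ fixedField T I.toSubmodule :=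
  and_congr_right fun hf => ((d.hasOrbitPolys hT hk).mem_fixedField_iff hf I).symm

theorem exists_mul_mem_locAlg (hT : IsRationalAction T) {k : ℕ} (hk : k ≤ m) {i : ℕ}
    (hi : i ≤ Module.finrank K L) {f : FractionRing A}
    (hf : f ∈ fixedField T (d.chain i).toSubmodule) :
    ∃ c ∈ locAlg K d.a0 k,
      c ≠ 0 ∧ c ∈ fixedField T (d.chain i).toSubmodule ∧ c * f ∈ locAlg K d.a0 k := by
  induction i with
  | zero =>
    obtain ⟨a, b, hb, rfl⟩ := IsFractionRing.div_surjective A f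
    have hb0 : algebraMap A (FractionRing A) b ≠ 0 := by simpa using nonZeroDivisors.ne_zero hb
    have regular_mem (a : A) : algebraMap A (FractionRing A) a ∈ locAlg K d.a0 k :=
      Algebra.subset_adjoin (.inl ⟨a, rfl⟩)
    refine ⟨_, regular_mem b, hb0, ?_, by simpa only [mul_div_cancel₀ _ hb0] using regular_mem a⟩
    rw [d.chain_zero, LieSubmodule.bot_toSubmodule, fixedField_bot]
    trivial
  | succ i ih =>
    obtain ⟨x, hx, hx'⟩ := d.exists_mem_chain_succ hi
    rw [d.chain_succ_eq_sup hi hx hx'] at hf ⊢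
    obtain ⟨c, hcB, hc0, hc, hcf⟩ := ih (by omega) (fixedField_anti le_sup_left hf)
    exact (d.hasOrbitPolys hT hk).exists_mul_mem_of_mem_fixedField_span hcB hc0 hc
      (fixedField_anti le_sup_right hf) hcf

theorem fixedField_chain_le (hT : IsRationalAction T) {k : ℕ} (hk : k ≤ m) {i : ℕ}
    (hi : i ≤ Module.finrank K L) {E : IntermediateField K (FractionRing A)}
    (hE : lieInvariants T d.a0 k (d.chain i) ⊆ E) :
    fixedField T (d.chain i).toSubmodule ≤ E := by
  intro f hf
  obtain ⟨c, hcB, hc0, hc, hcf⟩ := d.exists_mul_mem_locAlg hT hk hi hf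
  rw [← mul_div_cancel_left₀ f hc0]
  exact div_mem (hE ((d.mem_lieInvariants_iff hT hk).2 ⟨hcf, mul_mem hc hf⟩))
    (hE ((d.mem_lieInvariants_iff hT hk).2 ⟨hcB, hc⟩))

theorem fixedField_chain_eq (hT : IsRationalAction T) {k : ℕ} (hk : k ≤ m) {i j : ℕ} (hij : i ≤ j)
    (hj : j ≤ Module.finrank K L)
    (h : lieInvariants T d.a0 k (d.chain j) = lieInvariants T d.a0 k (d.chain i)) :
    fixedField T (d.chain j).toSubmodule = fixedField T (d.chain i).toSubmodule := by
  refine le_antisymm (fixedField_anti (d.chain_mono hij hj))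
    (d.fixedField_chain_le hT hk (hij.trans hj) ?_)
  exact h ▸ fun f hf => ((d.mem_lieInvariants_iff hT hk).1 hf).2

theorem fixedField_chain_pred_index_succ (hT : IsRationalAction T) {k : ℕ} (hk : k < m) :
    fixedField T (d.chain (d.index (k + 1) - 1)).toSubmodule =
      fixedField T (d.chain (d.index k)).toSubmodule := by
  have hlt := d.index_lt hk
  have hle : d.index (k + 1) ≤ _ := d.index_le hk
  refine d.fixedField_chain_eq hT hk.le (by omega) (by omega) ?_
  by_contra hne
  have hne' : d.index k ≠ d.index (k + 1) - 1 := fun h => hne (by rw [← h])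
  have := (d.index_least k hk).2 ⟨by omega, by omega, hne⟩
  omega

theorem fixedField_chain_index_succ (hT : IsRationalAction T) {k : ℕ} (hk : k < m) :
    fixedField T (d.chain (d.index (k + 1))).toSubmodule =
      fixedField T (d.chain (d.index k)).toSubmodule ⊓ fixedField T (K ∙ d.x (k + 1)) := by
  obtain ⟨i, hi⟩ := Nat.exists_eq_succ_of_ne_zero (d.index_lt hk).ne_bot
  have hx := d.x_mem k hk
  have hx' := d.x_notMem k hk
  have hle : d.index (k + 1) ≤ _ := d.index_le hk
  rw [← d.fixedField_chain_pred_index_succ hT hk, ← fixedField_sup]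
  rw [hi] at hx hx' hle ⊢
  rw [d.chain_succ_eq_sup hle hx hx', Nat.succ_sub_one]

theorem fixedField_chain_index_last (hT : IsRationalAction T) :
    fixedField T (d.chain (d.index m)).toSubmodule = fixedField T (⊤ : Submodule K L) := by
  have h := d.fixedField_chain_eq hT le_rfl (d.index_le le_rfl) le_rfl
    (d.stop_at _ (d.index_le le_rfl) le_rfl)
  rw [← h, d.chain_top, LieSubmodule.top_toSubmodule]

theorem a1_mem_fixedField (hT : IsRationalAction T) {k : ℕ} (hk : k < m) :
    d.a1 (k + 1) ∈ fixedField T (d.chain (d.index k)).toSubmodule :=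
  ((d.mem_lieInvariants_iff hT hk.le).1 (d.a1_mem k hk)).2

theorem slice_mem_fixedField (hT : IsRationalAction T) {k : ℕ} (hk : k < m) :
    d.slice (k + 1) ∈ fixedField T (d.chain (d.index k)).toSubmodule :=
  div_mem (d.a1_mem_fixedField hT hk) (fixedField_anti le_top (d.a0_mem_fixedField_top hT hk))

open Polynomial in
theorem isOrbitPoly_a1 (hT : IsRationalAction T) {k : ℕ} (hk : k < m) :
    IsOrbitPoly T (d.x (k + 1)) (d.a1 (k + 1)) (C (d.a0 (k + 1)) * X + C (d.a1 (k + 1))) := by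
  obtain ⟨q, -, hq⟩ := d.hasOrbitPolys hT hk.le _ (d.a1_mem k hk).1 (d.x (k + 1))
  have hlin := hq.eq_C_mul_X_add_C (by
    rw [d.lieDeriv_a1 k hk]
    exact fixedField_anti le_top (d.a0_mem_fixedField_top hT hk))
  rw [d.lieDeriv_a1 k hk] at hlin
  exact hlin ▸ hq

theorem sliceMap_a1 (hT : IsRationalAction T) {k : ℕ} (hk : k < m) :
    sliceMap T (d.x (k + 1)) (d.slice (k + 1)) (d.a1 (k + 1)) = 0 := by
  rw [(d.isOrbitPoly_a1 hT hk).sliceMap_eq]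
  simp [slice, mul_div_cancel₀ _ (d.a0_ne_zero k hk)]

open Polynomial in
theorem isOrbitPoly_slice (hT : IsRationalAction T) {k : ℕ} (hk : k < m) :
    IsOrbitPoly T (d.x (k + 1)) (d.slice (k + 1)) (X + C (d.slice (k + 1))) := by
  have ha0 := d.a0_ne_zero k hk
  have hinv : (d.a0 (k + 1))⁻¹ ∈ fixedField T (K ∙ d.x (k + 1)) :=
    inv_mem (fixedField_anti le_top (d.a0_mem_fixedField_top hT hk))
  convert (d.isOrbitPoly_a1 hT hk).mul (.of_mem_fixedField hinv) using 1
  · exact div_eq_mul_inv ..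
  · rw [add_mul, mul_right_comm, ← C_mul, ← C_mul, mul_inv_cancel₀ ha0, C_1, one_mul, slice,
      div_eq_mul_inv]

theorem sliceMap_mem_fixedField (hT : IsRationalAction T) {k : ℕ} (hk : k < m)
    {f : FractionRing A} (hf : f ∈ d.openAlg)
    (hfix : f ∈ fixedField T (d.chain (d.index k)).toSubmodule) :
    sliceMap T (d.x (k + 1)) (d.slice (k + 1)) f ∈
      fixedField T (d.chain (d.index (k + 1))).toSubmodule := by
  obtain ⟨q, -, hq⟩ := d.hasOrbitPolys hT le_rfl f hf (d.x (k + 1))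
  rw [d.fixedField_chain_index_succ hT hk]
  exact ⟨hq.sliceMap_mem_fixedField hfix (d.slice_mem_fixedField hT hk),
    hq.sliceMap_mem_fixedField_span (d.isOrbitPoly_slice hT hk)⟩

theorem partialProjector_eq_self (hT : IsRationalAction T) {k : ℕ} (hk : k ≤ m)
    {f : FractionRing A} (hf : f ∈ fixedField T (d.chain (d.index k)).toSubmodule) :
    d.partialProjector k f = f := by
  induction k with
  | zero => rfl
  | succ k ih =>
    rw [d.fixedField_chain_index_succ hT hk] at hf
    rw [partialProjector_succ, ih (by omega) hf.1, sliceMap_eq_self hf.2]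

theorem partialProjector_a1 (hT : IsRationalAction T) {k l : ℕ} (hk : k < l) (hl : l ≤ m) :
    d.partialProjector l (d.a1 (k + 1)) = 0 := by
  induction l, hk using Nat.le_induction with
  | base =>
    have hkm : k < m := hl
    rw [partialProjector_succ, d.partialProjector_eq_self hT hkm.le (d.a1_mem_fixedField hT hkm),
      d.sliceMap_a1 hT hkm]
  | succ l _ ih => rw [partialProjector_succ, ih (by omega), sliceMap_eq_self (zero_mem _)]

/-- The map `S_k ∘ ⋯ ∘ S_1` as an endomorphism of the algebra `K[X₀]`. -/
def partialProjectorHom (hT : IsRationalAction T) : ∀ k ≤ m, d.openAlg →ₐ[K] d.openAlg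
  | 0, _ => AlgHom.id K _
  | k + 1, hk => ((d.hasOrbitPolys hT le_rfl).sliceHom (d.x (k + 1))
      ⟨d.slice (k + 1), d.slice_mem_openAlg hk⟩).comp (partialProjectorHom hT k (by omega))

theorem coe_partialProjectorHom (hT : IsRationalAction T) {k : ℕ} (hk : k ≤ m) (f : d.openAlg) :
    (d.partialProjectorHom hT k hk f : FractionRing A) = d.partialProjector k f := by
  induction k with
  | zero => rfl
  | succ k ih => rw [partialProjector_succ, ← ih (by omega)]; rfl

theorem partialProjector_mem_fixedField (hT : IsRationalAction T) {k : ℕ} (hk : k ≤ m)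
    {f : FractionRing A} (hf : f ∈ d.openAlg) :
    d.partialProjector k f ∈ fixedField T (d.chain (d.index k)).toSubmodule := by
  induction k with
  | zero =>
    rw [d.index_zero, d.chain_zero, LieSubmodule.bot_toSubmodule, fixedField_bot]
    trivial
  | succ k ih =>
    refine d.sliceMap_mem_fixedField hT hk ?_ (ih (by omega))
    rw [← d.coe_partialProjectorHom hT (Nat.le_of_succ_le hk) ⟨f, hf⟩]
    exact SetLike.coe_mem _

/-- The `U`-projector `P` as an algebra homomorphism from `K[X₀]` to `K(X)`. -/
def projectorHom (hT : IsRationalAction T) : d.openAlg →ₐ[K] FractionRing A :=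
  d.openAlg.val.comp (d.partialProjectorHom hT m le_rfl)

theorem projectorHom_apply (hT : IsRationalAction T) (f : d.openAlg) :
    d.projectorHom hT f = d.partialProjector m f :=
  d.coe_partialProjectorHom hT le_rfl f

theorem projectorHom_eq_self (hT : IsRationalAction T) {f : d.openAlg}
    (hf : (f : FractionRing A) ∈ fixedField T (⊤ : Submodule K L)) : d.projectorHom hT f = f := by
  rw [projectorHom_apply, d.partialProjector_eq_self hT le_rfl (fixedField_anti le_top hf)]

theorem range_projectorHom (hT : IsRationalAction T) :
    (d.projectorHom hT).range = d.openAlg ⊓ (fixedField T (⊤ : Submodule K L)).toSubalgebra := by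
  refine le_antisymm ?_ fun f hf => ⟨⟨f, hf.1⟩, d.projectorHom_eq_self hT hf.2⟩
  rintro _ ⟨f, rfl⟩
  refine ⟨SetLike.coe_mem (d.partialProjectorHom hT m le_rfl f), ?_⟩
  rw [← d.fixedField_chain_index_last hT]
  exact d.projectorHom_apply hT f ▸ d.partialProjector_mem_fixedField hT le_rfl f.2

theorem ker_res_le_ker_projectorHom (hT : IsRationalAction T)
    (hideal : Ideal.span (Set.range d.a1Reg) = RingHom.ker d.res) :
    RingHom.ker d.res ≤ RingHom.ker (d.projectorHom hT) := by
  rw [← hideal, Ideal.span_le]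
  rintro _ ⟨k, rfl⟩
  exact (d.projectorHom_apply hT _).trans (d.partialProjector_a1 hT k.2 le_rfl)

variable {s : ℕ} (b : Fin s → A)

theorem projectorHom_image_eq_generators (hT : IsRationalAction T) :
    d.projectorHom hT '' (Set.range (fun i => d.toOpen (b i)) ∪ Set.range d.a0Reg ∪
      Set.range d.a0InvReg) = d.generators b := by
  have hb (i : Fin s) : d.projectorHom hT (d.toOpen (b i)) = d.projector (b i) :=
    d.projectorHom_apply hT _
  have ha0 (k : Fin m) : d.projectorHom hT (d.a0Reg k) = d.a0 (k + 1) :=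
    d.projectorHom_eq_self hT (d.a0_mem_fixedField_top hT k.2)
  have ha0Inv (k : Fin m) : d.projectorHom hT (d.a0InvReg k) = (d.a0 (k + 1))⁻¹ :=
    d.projectorHom_eq_self hT (inv_mem (d.a0_mem_fixedField_top hT k.2))
  simp only [Set.image_union, ← Set.range_comp, Function.comp_def, hb, ha0, ha0Inv, generators]

theorem adjoin_generators (hT : IsRationalAction T)
    (hideal : Ideal.span (Set.range d.a1Reg) = RingHom.ker d.res)
    (hgen : Algebra.adjoin K (Set.range (fun i => d.res (d.toOpen (b i))) ∪
        Set.range (fun k => d.res (d.a0Reg k)) ∪ Set.range (fun k => d.res (d.a0InvReg k))) =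
      d.res.range) :
    Algebra.adjoin K (d.generators b) =
      d.openAlg ⊓ (fixedField T (⊤ : Submodule K L)).toSubalgebra := by
  rw [← d.projectorHom_image_eq_generators b hT, ← d.range_projectorHom hT]
  refine adjoin_image_eq_range_of_ker_le (d.ker_res_le_ker_projectorHom hT hideal) ?_
  simpa only [Set.image_union, ← Set.range_comp, Function.comp_def] using hgen

theorem intermediateField_adjoin_eq_fixedField_top (hT : IsRationalAction T)
    {s : Set (FractionRing A)} (hs : Algebra.adjoin K s =
      d.openAlg ⊓ (fixedField T (⊤ : Submodule K L)).toSubalgebra) :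
    IntermediateField.adjoin K s = fixedField T (⊤ : Submodule K L) := by
  have hsub : s ⊆ Algebra.adjoin K s := Algebra.subset_adjoin
  rw [hs] at hsub
  refine le_antisymm (IntermediateField.adjoin_le_iff.2 fun f hf => (hsub hf).2) ?_
  have htop : (d.chain (Module.finrank K L)).toSubmodule = ⊤ := by
    rw [d.chain_top, LieSubmodule.top_toSubmodule]
  rw [← htop] at hs ⊢
  refine d.fixedField_chain_le hT le_rfl le_rfl fun f hf => ?_
  rw [d.mem_lieInvariants_iff hT le_rfl] at hf
  exact IntermediateField.algebra_adjoin_le_adjoin K s (hs.symm ▸ hf)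

end ProjectorData

end

theorem theorem3_general {K L A : Type*} [Field K] [CharZero K]
    [LieRing L] [LieAlgebra K L] [FiniteDimensional K L]
    [CommRing A] [IsDomain A] [Algebra K A]
    (T : ExpGroup K L →ₙ* (A ≃ₐ[K] A)) (hT : IsRationalAction T)
    {m : ℕ} (d : ProjectorData T m)
    (hideal : Ideal.span (Set.range d.a1Reg) = RingHom.ker d.res)
    {s : ℕ} (b : Fin s → A)
    (hgen : Algebra.adjoin K (Set.range (fun i => d.res (d.toOpen (b i))) ∪
        Set.range (fun k => d.res (d.a0Reg k)) ∪ Set.range (fun k => d.res (d.a0InvReg k))) =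
      d.res.range) :
    (Algebra.adjoin K (d.generators b) : Set (FractionRing A)) =
        {f | f ∈ d.openAlg ∧ ∀ g, ratAct T g f = f} ∧
      (IntermediateField.adjoin K (d.generators b) : Set (FractionRing A)) =
        {f | ∀ g, ratAct T g f = f} := by
  have halg := d.adjoin_generators b hT hideal hgen
  have hfield := d.intermediateField_adjoin_eq_fixedField_top hT halg
  constructor
  · ext f
    rw [halg]
    exact and_congr_right fun _ => mem_fixedField_top
  · ext f
    rw [hfield]
    exact mem_fixedField_top

theorem theorem3 {K L A : Type*} [Field K] [CharZero K]
    [LieRing L] [LieAlgebra K L] [FiniteDimensional K L] [LieRing.IsNilpotent L]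
    [CommRing A] [IsDomain A] [Algebra K A] [Algebra.FiniteType K A]
    (T : ExpGroup K L →ₙ* (A ≃ₐ[K] A)) (hT : IsRationalAction T)
    {m : ℕ} (d : ProjectorData T m)
    (hideal : Ideal.span (Set.range d.a1Reg) = RingHom.ker d.res)
    {s : ℕ} (b : Fin s → A)
    (hgen : Algebra.adjoin K (Set.range (fun i => d.res (d.toOpen (b i))) ∪
        Set.range (fun k => d.res (d.a0Reg k)) ∪ Set.range (fun k => d.res (d.a0InvReg k))) =
      d.res.range) :
    (Algebra.adjoin K (d.generators b) : Set (FractionRing A)) =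
        {f | f ∈ d.openAlg ∧ ∀ g, ratAct T g f = f} ∧
      (IntermediateField.adjoin K (d.generators b) : Set (FractionRing A)) =
        {f | ∀ g, ratAct T g f = f} :=
  theorem3_general T hT d hideal b hgen
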